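/- \textbf{Setting.} A finite set $\mathcal J$ of jobs is given; job $j$ has weight $w_j>0$ and consists of at least one Map task and at least one Reduce task. Let $\mathcal M,\mathcal R$ be the sets of all Map and all Reduce tasks, and let $\mathcal P_{\mathcal M},\mathcal P_{\mathcal R}$ be disjoint nonempty finite sets of unrelated processors. For $b\in\{\mathcal M,\mathcal R\}$, a task $k\in b$ takes time $p_{i,k}>0$ on processor $i\in\mathcal P_b$. Fix a time unit $u>0$ with $u\le p_{i,k}$ for all $i,k$ (for positive integral processing times, $u=1$). A schedule runs each task non-preemptively on one processor of its own kind, from some start time $\ge 0$ on, and no processor runs two tasks at a time. In a MapReduce schedule, moreover, no Reduce task may start before all Map tasks of its job are completed. For a schedule $\sigma$ of $b$ alone, $C_j^\sigma$ is the completion time of the last task of job $j$ in $b$; for a MapReduce schedule, $C_j$ is the completion time of the last Reduce task of $j$. The cost is the total weighted completion time, $\sum_j w_jC_j^\sigma$ or $\sum_j w_jC_j$. \textbf{TaskScheduling}$(b)$. Let $\delta=\tfrac12$, $a=\tfrac32$, $\tau_\ell=u(1+\delta)^\ell$, and let $L\ge 1$ be the smallest integer with $\tau_{L-1}\ge\sum_{k\in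 b}\max_{i}p_{i,k}$. Take an optimal solution of the linear program that minimizes $\sum_jw_jD_j$ over $y_{i,k,\ell}\ge0$ ($i\in\mathcal P_b$, $k\in b$, $1\le\ell\le L$), $C_k$, $D_j$ subject to: $\sum_{i,\ell}y_{i,k,\ell}\ge1$ for each $k$; $D_j\ge C_k$ for each task $k$ of job $j$; $\sum_{i,\ell}\tau_{\ell-1}y_{i,k,\ell}\le C_k$ for each $k$; $\sum_kp_{i,k}\sum_{t\le\ell}y_{i,k,t}\le\tau_\ell$ for all $i,\ell$; and $y_{i,k,\ell}=0$ whenever $p_{i,k}>\tau_\ell$. Put each task $k$ into a class $S(\ell)$, $1\le\ell\le L$, with $\tau_{\ell-1}\le aC_k\le\tau_\ell$, and for $k\in S(\ell)$ let $x_{i,k}=\frac a{a-1}\sum_{t\le\ell}y_{i,k,t}$. Round $x$ in each class separately to an integral assignment by the Shmoys--Tardos procedure: on each processor, lay out the amounts $x_{i,k}$ of the tasks of the class one after another in order of non-increasing $p_{i,k}$, cut this layout into unit slots, and match all tasks of the class to pairwise different slots such that each task has a positive part of its amount in its slot. Every processor then executes the tasks assigned to it class after class, in increasing order of $\ell$,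 from time $0$ on and without idle time. \textbf{MRS.} Let $\sigma_{\mathcal M},\sigma_{\mathcal R}$ be outputs of TaskScheduling for $b=\mathcal M$ and $b=\mathcal R$, and let $\omega_j=\max\{C_j^{\sigma_{\mathcal M}},C_j^{\sigma_{\mathcal R}}\}$ be the width of job $j$. All tasks stay on their processors. Whenever a Map processor becomes available, it starts its unscheduled task of smallest width; whenever a Reduce processor is available at a time $t$, it starts, among its unscheduled tasks with $\omega_j\le t$, one of smallest width (and waits if there is none). \textbf{Theorem 2.} For all ways of breaking ties and making the arbitrary choices above: (1) the algorithm can always be carried out: the linear programs have optimal solutions, every optimal solution can be rounded as described (for suitable classes, orders and matchings), and any two outputs $\sigma_{\mathcal M},\sigma_{\mathcal R}$ can be merged; (2) $\sigma_{\mathcal M}$ and $\sigma_{\mathcal R}$ are feasible schedules of the Map tasks and of the Reduce tasks, and each has cost at most $\frac{27}2$ times that of any feasible schedule of the Map tasks alone, respectively of the Reduce tasks alone; (3) MRS outputs a non-preemptive MapReduce schedule that respects the precedence constraints and has cost at most $54$ times that of any feasible MapReduce schedule, that is, at most $54$ times the optimum. -/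

import Mathlib

namespace MapReduce

open Finset

/-- One stage (all Map tasks, or all Reduce tasks) of a set `J` of jobs: a finite set `T` of tasks,
each belonging to a job, every job having at least one task, and a set `P` of unrelated processors.
`time i k` is the processing time of task `k` on processor `i`. -/
structure Stage (J T P : Type*) where
  /-- the job of a task -/
  job : T → J
  /-- every job has at least one task -/
  job_surjective : Function.Surjective job
  /-- the processing times -/
  time : P → T → ℝ
  time_pos : ∀ i k, 0 < time i k

/-- A non-preemptive schedule of the tasks `T` on the processors `P`: every task runs on one
processor, without interruption, from its start time on. -/
structure Schedule (T P : Type*) where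
  /-- the processor on which a task is executed -/
  proc : T → P
  /-- the time at which a task starts -/
  start : T → ℝ

/-- An instance of the MapReduce problem.  The Map processors `PM` and the Reduce processors `PR`
are two different types, that is, the two sets of processors are disjoint. -/
structure Instance (J TM PM TR PR : Type*) where
  /-- the weights of the jobs -/
  weight : J → ℝ
  weight_pos : ∀ j, 0 < weight j
  /-- the Map tasks on the Map processors -/
  mapStage : Stage J TM PM
  /-- the Reduce tasks on the Reduce processors -/
  reduceStage : Stage J TR PR

/-- A schedule of all Map tasks on Map processors and all Reduce tasks on Reduce processors. -/
structure MRSchedule (TM PM TR PR : Type*) where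
  /-- the schedule of the Map tasks -/
  mapSched : Schedule TM PM
  /-- the schedule of the Reduce tasks -/
  reduceSched : Schedule TR PR

/-! ### Feasible schedules and their cost -/

section StageSchedules

variable {J T P : Type*} (S : Stage J T P)

/-- The completion time `C_{k,j}` of a task. -/
def Stage.completion (σ : Schedule T P) (k : T) : ℝ :=
  σ.start k + S.time (σ.proc k) k

/-- A schedule of one stage is feasible if nothing starts before time zero and no processor
executes two tasks at a time. -/
def Stage.Feasible (σ : Schedule T P) : Prop :=
  (∀ k, 0 ≤ σ.start k) ∧
  ∀ k k', k ≠ k' → σ.proc k = σ.proc k' →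
    S.completion σ k ≤ σ.start k' ∨ S.completion σ k' ≤ σ.start k

variable [Fintype T] [DecidableEq J]

/-- The tasks of job `j` in the stage. -/
def Stage.tasks (j : J) : Finset T := univ.filter fun k => S.job k = j

theorem Stage.tasks_nonempty (j : J) : (S.tasks j).Nonempty := by
  obtain ⟨k, hk⟩ := S.job_surjective j
  exact ⟨k, by simp [Stage.tasks, hk]⟩

/-- The time at which the last task of job `j` in the stage completes. -/
def Stage.jobCompletion (σ : Schedule T P) (j : J) : ℝ :=
  (S.tasks j).sup' (S.tasks_nonempty j) (S.completion σ)

/-- The total weighted completion time of a schedule of the stage. -/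
def Stage.cost [Fintype J] (w : J → ℝ) (σ : Schedule T P) : ℝ :=
  ∑ j, w j * S.jobCompletion σ j

end StageSchedules

section MRSchedules

variable {J TM PM TR PR : Type*} (I : Instance J TM PM TR PR)

/-- A MapReduce schedule is feasible if both stages are, and no Reduce task starts before all
Map tasks of the same job are completed. -/
def Instance.Feasible (σ : MRSchedule TM PM TR PR) : Prop :=
  I.mapStage.Feasible σ.mapSched ∧ I.reduceStage.Feasible σ.reduceSched ∧
  ∀ (m : TM) (r : TR), I.mapStage.job m = I.reduceStage.job r →
    I.mapStage.completion σ.mapSched m ≤ σ.reduceSched.start r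

/-- The total weighted completion time `∑ j, w_j * C_j`, where `C_j` is the completion time of the
last Reduce task of job `j`. -/
def Instance.cost [Fintype J] [DecidableEq J] [Fintype TR] (σ : MRSchedule TM PM TR PR) : ℝ :=
  ∑ j, I.weight j * I.reduceStage.jobCompletion σ.reduceSched j

end MRSchedules

/-! ### Greedy dispatching on one processor -/

/-- The possible runs of the dispatching loop of one processor.  `Dispatch len prio release t U s`
says: if the processor becomes available at time `t` and `U` is the set of its unscheduled tasks,
the loop may give these tasks the start times `s`.  Whenever the processor is available, it starts,
among the unscheduled tasks that are already released, one with the smallest priority value; if no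
unscheduled task is released, it waits until the next release.  Ties are broken arbitrarily. -/
inductive Dispatch {T : Type*} [DecidableEq T] (len prio release : T → ℝ) :
    ℝ → Finset T → (T → ℝ) → Prop
  | done (t : ℝ) (s : T → ℝ) : Dispatch len prio release t ∅ s
  | run (t : ℝ) (U : Finset T) (s : T → ℝ) (k : T) (hk : k ∈ U) (hrel : release k ≤ t)
      (hmin : ∀ k' ∈ U, release k' ≤ t → prio k ≤ prio k') (hs : s k = t)
      (rest : Dispatch len prio release (t + len k) (U.erase k) s) :
      Dispatch len prio release t U s
  | wait (t : ℝ) (U : Finset T) (s : T → ℝ) (k : T) (hk : k ∈ U)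
      (hnext : ∀ k' ∈ U, release k ≤ release k') (hlt : t < release k)
      (rest : Dispatch len prio release (release k) U s) :
      Dispatch len prio release t U s

/-- In the schedule `σ`, every processor dispatches the tasks assigned to it from time zero on, with
the given priorities and release times. -/
def Stage.Dispatched {J T P : Type*} [Fintype T] [DecidableEq T] [DecidableEq P]
    (S : Stage J T P) (prio release : T → ℝ) (σ : Schedule T P) : Prop :=
  ∀ i, Dispatch (S.time i) prio release 0 (univ.filter fun k => σ.proc k = i) σ.start

/-! ### The interval-indexed linear program -/

/-- The parameter `δ = 1/2`: the interval end points grow by the factor `1 + δ`. -/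
noncomputable def delta : ℝ := 1 / 2

/-- The parameter `a = 3/2` of the rounding. -/
noncomputable def slack : ℝ := 3 / 2

/-- The end points `u * (1 + δ) ^ ℓ` of the time intervals, where `u` is the time unit (`u = 1` for
integral processing times).  Interval number `ℓ ≥ 1` is `(endpoint u (ℓ - 1), endpoint u ℓ]`. -/
noncomputable def endpoint (u : ℝ) (ℓ : ℕ) : ℝ := u * (1 + delta) ^ ℓ

section LP

variable {J T P : Type*} [Fintype T] [Fintype P]

/-- The time horizon `t_max`: the sum over all tasks of the largest processing time. -/
noncomputable def Stage.horizon [Nonempty P] (S : Stage J T P) : ℝ :=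
  ∑ k, univ.sup' univ_nonempty fun i => S.time i k

/-- The number `L` of intervals: the smallest `L ≥ 1` with `u * (1 + δ) ^ (L - 1) ≥ t_max`. -/
noncomputable def Stage.numIntervals [Nonempty P] (S : Stage J T P) (u : ℝ) : ℕ :=
  sInf {L : ℕ | 1 ≤ L ∧ S.horizon ≤ endpoint u (L - 1)}

/-- The variables of the linear program: `y i k ℓ` for the completion of task `k` on processor `i`
in interval `ℓ` (only `1 ≤ ℓ ≤ L` matters), `C k` for the completion time of task `k`, and `D j` for
that of the dummy last task of job `j`. -/
structure LPPoint (J T P : Type*) where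
  /-- the fractional assignment -/
  y : P → T → ℕ → ℝ
  /-- the completion times of the tasks -/
  C : T → ℝ
  /-- the completion times of the jobs -/
  D : J → ℝ

/-- The constraints of the linear program with `L` intervals and time unit `u`. -/
structure Stage.LPFeasible (S : Stage J T P) (u : ℝ) (L : ℕ) (x : LPPoint J T P) : Prop where
  covered : ∀ k, 1 ≤ ∑ i, ∑ ℓ ∈ Icc 1 L, x.y i k ℓ
  dummy_last : ∀ k, x.C k ≤ x.D (S.job k)
  completion_ge : ∀ k, ∑ i, ∑ ℓ ∈ Icc 1 L, endpoint u (ℓ - 1) * x.y i k ℓ ≤ x.C k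
  load_le : ∀ i, ∀ ℓ ∈ Icc 1 L, ∑ k, S.time i k * ∑ t ∈ Icc 1 ℓ, x.y i k t ≤ endpoint u ℓ
  too_long : ∀ i k, ∀ ℓ ∈ Icc 1 L, endpoint u ℓ < S.time i k → x.y i k ℓ = 0
  nonneg : ∀ i k, ∀ ℓ ∈ Icc 1 L, 0 ≤ x.y i k ℓ

/-- `x` is an optimal solution of the linear program: it is feasible and minimizes
`∑ j, w_j * D_j`. -/
def Stage.LPOptimal [Fintype J] [Nonempty P] (S : Stage J T P) (w : J → ℝ) (u : ℝ)
    (x : LPPoint J T P) : Prop :=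
  S.LPFeasible u (S.numIntervals u) x ∧
  ∀ x' : LPPoint J T P, S.LPFeasible u (S.numIntervals u) x' →
    ∑ j, w j * x.D j ≤ ∑ j, w j * x'.D j

end LP

/-! ### TaskScheduling: rounding the linear program -/

section Rounding

variable {J T P : Type*} [Fintype T]

/-- `cls` sorts the tasks into classes: `cls k = ℓ` only if `1 ≤ ℓ ≤ L` and `a * C k` lies in the
closed interval number `ℓ`. -/
def IsClassification (u : ℝ) (L : ℕ) (C : T → ℝ) (cls : T → ℕ) : Prop :=
  ∀ k, cls k ∈ Icc 1 L ∧ endpoint u (cls k - 1) ≤ slack * C k ∧ slack * C k ≤ endpoint u (cls k)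

/-- The truncated and rescaled fractional assignment of task `k` to processor `i`: only the
intervals up to the class of `k` are kept, and the values are multiplied by `a / (a - 1)`. -/
noncomputable def truncated (y : P → T → ℕ → ℝ) (cls : T → ℕ) (i : P) (k : T) : ℝ :=
  slack / (slack - 1) * ∑ t ∈ Icc 1 (cls k), y i k t

/-- `rank i` lists the tasks in the order of non-increasing processing times on processor `i`. -/
def Stage.IsSorting (S : Stage J T P) (rank : P → T → ℕ) : Prop :=
  ∀ i, Function.Injective (rank i) ∧ ∀ k k', rank i k < rank i k' → S.time i k' ≤ S.time i k

/-- The fractional amount, on processor `i`, of the tasks that are in the class of `k` and precede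
`k` in the sorted list of processor `i`. -/
def amountBefore (x : P → T → ℝ) (cls : T → ℕ) (rank : P → T → ℕ) (i : P) (k : T) : ℝ :=
  ∑ k' ∈ univ.filter (fun k' => cls k' = cls k ∧ rank i k' < rank i k), x i k'

/-- The Shmoys-Tardos rounding of a fractional assignment `x`, applied to each class of tasks
separately.  On processor `i`, the amounts `x i k` of the tasks `k` of one class are laid out one
after another in sorted order; slot number `s` of the processor is the interval `(s, s + 1)` of this
layout, and task `k` is adjacent to the slot if a part of positive length of its amount lies in it.
The tasks of the class are then matched to adjacent slots, all to different ones, and `proc` is the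
resulting assignment of tasks to processors. -/
def IsSlotRounding (x : P → T → ℝ) (cls : T → ℕ) (rank : P → T → ℕ) (proc : T → P) : Prop :=
  ∃ slot : T → ℕ,
    (∀ k, 0 < x (proc k) k ∧ amountBefore x cls rank (proc k) k < slot k + 1 ∧
      (slot k : ℝ) < amountBefore x cls rank (proc k) k + x (proc k) k) ∧
    ∀ k k', cls k = cls k' → proc k = proc k' → slot k = slot k' → k = k'

variable [Fintype P] [Nonempty P] [DecidableEq T] [DecidableEq P]

/-- `σ` is a possible output of TaskScheduling started from the fractional solution `x` of the linear
program: the tasks are sorted into classes, each class is rounded to an integral assignment, and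
every processor executes its tasks class after class, in the order of increasing classes and
without idle time. -/
def Stage.IsRounded (S : Stage J T P) (u : ℝ) (x : LPPoint J T P) (σ : Schedule T P) : Prop :=
  ∃ (cls : T → ℕ) (rank : P → T → ℕ),
    IsClassification u (S.numIntervals u) x.C cls ∧ S.IsSorting rank ∧
    IsSlotRounding (truncated x.y cls) cls rank σ.proc ∧
    S.Dispatched (fun k => (cls k : ℝ)) (fun _ => 0) σ

/-- `σ` is a possible output of TaskScheduling: it is obtained by rounding some optimal solution of
the linear program. -/
def Stage.IsTaskScheduling [Fintype J] (S : Stage J T P) (w : J → ℝ) (u : ℝ)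
    (σ : Schedule T P) : Prop :=
  ∃ x : LPPoint J T P, S.LPOptimal w u x ∧ S.IsRounded u x σ

end Rounding

/-! ### MRS: merging the two schedules -/

section Merging

variable {J TM PM TR PR : Type*} [DecidableEq J] [Fintype TM] [Fintype TR]
  (I : Instance J TM PM TR PR)

/-- The width of job `j` with respect to a schedule of the Map tasks and one of the Reduce tasks. -/
def Instance.width (σM : Schedule TM PM) (σR : Schedule TR PR) (j : J) : ℝ :=
  max (I.mapStage.jobCompletion σM j) (I.reduceStage.jobCompletion σR j)

/-- `σ` is a possible output of MRS for the given schedules `σM` and `σR` of the Map and the Reduce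
tasks: all tasks stay on their processors; the Map processors dispatch their tasks by smallest
width; the Reduce processors do the same, each Reduce task being released at the width of its
job. -/
def Instance.IsMerged [DecidableEq TM] [DecidableEq TR] [DecidableEq PM] [DecidableEq PR]
    (σM : Schedule TM PM) (σR : Schedule TR PR) (σ : MRSchedule TM PM TR PR) : Prop :=
  σ.mapSched.proc = σM.proc ∧ σ.reduceSched.proc = σR.proc ∧
  I.mapStage.Dispatched (fun k => I.width σM σR (I.mapStage.job k)) (fun _ => 0) σ.mapSched ∧
  I.reduceStage.Dispatched (fun k => I.width σM σR (I.reduceStage.job k))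
    (fun k => I.width σM σR (I.reduceStage.job k)) σ.reduceSched

end Merging

end MapReduce

/-! Write τ_ℓ for `endpoint u ℓ`. The linear program relaxes each stage: placing every task of a
feasible schedule into the interval of its completion time gives a solution in which `D` is the
vector of job completion times (`Stage.Feasible.exists_lpFeasible`). The optimal value is therefore
a lower bound on every cost.

Rounding delays a task by a factor of at most 27/2. By a Markov argument, at most 1/a = 2/3 of a
unit of task k lies beyond its class, so tripling what lies up to the class covers the task
(`Stage.LPFeasible.one_le_sum_truncated`), and Hall's theorem yields the matching to slots. A task
in slot s + 1 is no longer than the average over the full slot s, so rounding class c adds at most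
τ_c to the load of a processor (`IsSlotRounding.load_le`). The classes up to ℓ then take at most
3τ_ℓ (the added terms) plus 3τ_ℓ (the tripled fractional load), and 6τ_ℓ = 9τ_{ℓ-1} ≤ 9aC_k =
(27/2)C_k for k in class ℓ.

In the separate schedules, the tasks of width at most ω on one processor fit into [0, ω]. Hence the
merged Map tasks end by their width, and the Reduce tasks, held back until then, by twice their
width. The width is at most the sum of the two stage completion times, which gives 2(27/2 + 27/2) =
54. -/

namespace MapReduce

open Finset

/-! ### Volume bound for one processor -/

section Packing

variable {J T P : Type*} {S : Stage J T P} {σ : Schedule T P}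

theorem Stage.Feasible.completion_nonneg (h : S.Feasible σ) (k : T) :
    0 ≤ S.completion σ k :=
  add_nonneg (h.1 k) (S.time_pos _ k).le

/-- Tasks that run on one processor and are completed by time `b` have total length at most `b`. -/
theorem Stage.Feasible.sum_time_le (h : S.Feasible σ) (i : P) {b : ℝ} (hb : 0 ≤ b)
    (A : Finset T) (hproc : ∀ k ∈ A, σ.proc k = i) (hA : ∀ k ∈ A, S.completion σ k ≤ b) :
    ∑ k ∈ A, S.time i k ≤ b := by
  classical
  -- Remove the task that completes last: all others end before it starts, so its start time is the
  -- new bound.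
  induction A using Finset.induction_on_max_value (S.completion σ) generalizing b with
  | empty => simpa using hb
  | insert a A ha hmax ih =>
    have hpa : σ.proc a = i := hproc a (mem_insert_self a A)
    have hca := hA a (mem_insert_self a A)
    have hcompl : S.completion σ a = σ.start a + S.time i a := by rw [Stage.completion, hpa]
    have hrest : ∑ k ∈ A, S.time i k ≤ σ.start a := by
      refine ih (h.1 a) (fun k hk => hproc k (mem_insert_of_mem hk)) fun k hk => ?_
      have hka : k ≠ a := fun e => ha (e ▸ hk)
      have hpk : σ.proc k = i := hproc k (mem_insert_of_mem hk)
      rcases h.2 k a hka (hpk.trans hpa.symm) with h1 | h1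
      · exact h1
      -- The other order would make `k` complete strictly after `a`, against the choice of `a`.
      · have h2 := hmax k hk
        have h3 : S.completion σ k = σ.start k + S.time i k := by rw [Stage.completion, hpk]
        have h4 := S.time_pos i k
        linarith
    rw [sum_insert ha]
    linarith

end Packing

/-! ### Existence and delay bounds for greedy dispatching -/

section Dispatching

variable {T : Type*} [DecidableEq T] {len prio release : T → ℝ}

/-- Needed to glue the runs of the different processors into one function of start times. -/
theorem Dispatch.congr {t : ℝ} {U : Finset T} {s s' : T → ℝ}
    (h : Dispatch len prio release t U s) (hs : ∀ k ∈ U, s k = s' k) :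
    Dispatch len prio release t U s' := by
  induction h with
  | done t s => exact .done t s'
  | run t U s k hk hrel hmin hsk _ ih =>
    exact .run t U s' k hk hrel hmin ((hs k hk).symm.trans hsk)
      (ih fun k' hk' => hs k' (mem_of_mem_erase hk'))
  | wait t U s k hk hnext hlt _ ih => exact .wait t U s' k hk hnext hlt (ih hs)

theorem Dispatch.exists (len prio release : T → ℝ) (t : ℝ) (U : Finset T) :
    ∃ s, Dispatch len prio release t U s := by
  induction U using Finset.strongInduction generalizing t with
  | H U ih =>
    have main : ∀ t, (∃ k ∈ U, release k ≤ t) → ∃ s, Dispatch len prio release t U s := by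
      rintro t ⟨k₀, hk₀, hr₀⟩
      obtain ⟨k, hk, hmin⟩ := exists_min_image (U.filter fun k => release k ≤ t) prio
        ⟨k₀, by simp [hk₀, hr₀]⟩
      rw [mem_filter] at hk
      obtain ⟨s, hs⟩ := ih (U.erase k) (erase_ssubset hk.1) (t + len k)
      refine ⟨Function.update s k t, .run t U _ k hk.1 hk.2
        (fun k' hk' hr' => hmin k' (by simp [hk', hr'])) (by simp) (hs.congr fun k' hk' => ?_)⟩
      rw [Function.update_of_ne (ne_of_mem_erase hk')]
    rcases U.eq_empty_or_nonempty with rfl | hU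
    · exact ⟨0, .done t 0⟩
    · obtain ⟨k, hk, hnext⟩ := exists_min_image U release hU
      rcases le_or_gt (release k) t with hle | hlt
      · exact main t ⟨k, hk, hle⟩
      · obtain ⟨s, hs⟩ := main (release k) ⟨k, hk, le_rfl⟩
        exact ⟨s, .wait t U s k hk hnext hlt hs⟩

theorem Dispatch.le_start {t : ℝ} {U : Finset T} {s : T → ℝ}
    (h : Dispatch len prio release t U s) (hlen : ∀ k, 0 < len k) :
    ∀ k ∈ U, t ≤ s k := by
  induction h with
  | done => simp
  | run t U s k hk hrel hmin hsk _ ih =>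
    intro k' hk'
    by_cases e : k' = k
    · rw [e, hsk]
    · have h1 := ih k' (mem_erase.2 ⟨e, hk'⟩)
      have h2 := hlen k
      linarith
  | wait t U s k hk hnext hlt _ ih => exact fun k' hk' => hlt.le.trans (ih k' hk')

theorem Dispatch.release_le_start {t : ℝ} {U : Finset T} {s : T → ℝ}
    (h : Dispatch len prio release t U s) : ∀ k ∈ U, release k ≤ s k := by
  induction h with
  | done => simp
  | run t U s k hk hrel hmin hsk _ ih =>
    intro k' hk'
    by_cases e : k' = k
    · rwa [e, hsk]
    · exact ih k' (mem_erase.2 ⟨e, hk'⟩)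
  | wait t U s k hk hnext hlt _ ih => exact ih

theorem Dispatch.disjoint {t : ℝ} {U : Finset T} {s : T → ℝ}
    (h : Dispatch len prio release t U s) (hlen : ∀ k, 0 < len k) :
    ∀ k ∈ U, ∀ k' ∈ U, k ≠ k' → s k + len k ≤ s k' ∨ s k' + len k' ≤ s k := by
  induction h with
  | done => simp
  | run t U s k₀ hk₀ hrel hmin hsk rest ih =>
    intro k hk k' hk' hne
    have hrest := rest.le_start hlen
    by_cases e : k = k₀
    · subst e
      rw [hsk]
      exact .inl (hrest k' (mem_erase.2 ⟨hne.symm, hk'⟩))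
    by_cases e' : k' = k₀
    · subst e'
      rw [hsk]
      exact .inr (hrest k (mem_erase.2 ⟨e, hk⟩))
    exact ih k (mem_erase.2 ⟨e, hk⟩) k' (mem_erase.2 ⟨e', hk'⟩) hne
  | wait t U s k hk hnext hlt _ ih => exact ih

/-- If tasks of smaller priority value are released earlier, then from its release on a task is
delayed only by tasks whose priority value is not larger. -/
theorem Dispatch.completion_le {t : ℝ} {U : Finset T} {s : T → ℝ}
    (h : Dispatch len prio release t U s) (hlen : ∀ k, 0 < len k)
    (hmono : ∀ k k', prio k < prio k' → release k ≤ release k') :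
    ∀ k ∈ U, s k + len k ≤
      max t (release k) + ∑ k' ∈ U.filter (fun k' => prio k' ≤ prio k), len k' := by
  induction h with
  | done => simp
  | run t U s k₀ hk₀ hrel hmin hsk rest ih =>
    intro k hk
    by_cases e : k = k₀
    · subst e
      have h1 : len k ≤ ∑ k' ∈ U.filter (fun k' => prio k' ≤ prio k), len k' :=
        single_le_sum (f := len) (fun k' _ => (hlen k').le) (by simp [hk])
      have h2 := le_max_left t (release k)
      linarith
    · have h1 := ih k (mem_erase.2 ⟨e, hk⟩)
      -- If `k` had smaller priority value than `k₀`, it would already be released and would have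
      -- been preferred.
      have hprio : prio k₀ ≤ prio k := by
        by_contra hlt
        push Not at hlt
        exact absurd (hmin k hk ((hmono k k₀ hlt).trans hrel)) (not_le.2 hlt)
      have h2 : ∑ k' ∈ U.filter (fun k' => prio k' ≤ prio k), len k' =
          len k₀ + ∑ k' ∈ (U.erase k₀).filter (fun k' => prio k' ≤ prio k), len k' := by
        rw [filter_erase, add_sum_erase _ _ (by simp [hk₀, hprio])]
      have h3 : max (t + len k₀) (release k) ≤ max t (release k) + len k₀ :=
        max_le (by linarith [le_max_left t (release k)])
          (by linarith [le_max_right t (release k), hlen k₀])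
      linarith
  | wait t U s k₀ hk₀ hnext hlt _ ih =>
    intro k hk
    have h1 := ih k hk
    rw [max_eq_right (hnext k hk)] at h1
    linarith [le_max_right t (release k)]

end Dispatching

section Dispatched

variable {J T P : Type*} [Fintype T] [DecidableEq T] [DecidableEq P]
  {S : Stage J T P} {prio release : T → ℝ}

theorem Stage.exists_dispatched (S : Stage J T P) (prio release : T → ℝ) (proc : T → P) :
    ∃ σ : Schedule T P, σ.proc = proc ∧ S.Dispatched prio release σ := by
  choose s hs using fun i =>
    Dispatch.exists (S.time i) prio release 0 (univ.filter fun k => proc k = i)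
  refine ⟨⟨proc, fun k => s (proc k) k⟩, rfl, fun i => (hs i).congr fun k hk => ?_⟩
  simp only [(mem_filter.1 hk).2]

theorem Stage.Dispatched.feasible {σ : Schedule T P} (h : S.Dispatched prio release σ) :
    S.Feasible σ := by
  refine ⟨fun k => (h (σ.proc k)).le_start (S.time_pos _) k (by simp), fun k k' hne hp => ?_⟩
  have := (h (σ.proc k)).disjoint (S.time_pos _) k (by simp) k' (by simp [hp]) hne
  simpa only [Stage.completion, hp] using this

theorem Stage.Dispatched.release_le_start {σ : Schedule T P} (h : S.Dispatched prio release σ)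
    (k : T) : release k ≤ σ.start k :=
  (h (σ.proc k)).release_le_start k (by simp)

theorem Stage.Dispatched.completion_le {σ : Schedule T P} (h : S.Dispatched prio release σ)
    (hmono : ∀ k k', prio k < prio k' → release k ≤ release k') (k : T) :
    S.completion σ k ≤ max 0 (release k) +
      ∑ k' ∈ univ.filter (fun k' => σ.proc k' = σ.proc k ∧ prio k' ≤ prio k),
        S.time (σ.proc k) k' := by
  have := (h (σ.proc k)).completion_le (S.time_pos _) hmono k (by simp)
  rwa [filter_filter] at this

end Dispatched

section JobCompletion

variable {J T P : Type*} [Fintype T] [DecidableEq J] {S : Stage J T P}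

theorem Stage.completion_le_jobCompletion (S : Stage J T P) (σ : Schedule T P) (k : T) :
    S.completion σ k ≤ S.jobCompletion σ (S.job k) :=
  le_sup' _ (by simp [Stage.tasks])

theorem Stage.jobCompletion_le {σ : Schedule T P} {j : J} {b : ℝ}
    (h : ∀ k, S.job k = j → S.completion σ k ≤ b) : S.jobCompletion σ j ≤ b :=
  sup'_le _ _ fun k hk => h k (by simpa [Stage.tasks] using hk)

theorem Stage.Feasible.jobCompletion_nonneg {σ : Schedule T P} (h : S.Feasible σ) (j : J) :
    0 ≤ S.jobCompletion σ j := by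
  obtain ⟨k, rfl⟩ := S.job_surjective j
  exact (h.completion_nonneg k).trans (S.completion_le_jobCompletion σ k)

end JobCompletion

/-! ### Merging the two stages -/

section Merge

variable {J TM PM TR PR : Type*} [DecidableEq J] [Fintype TM] [Fintype TR]
  {I : Instance J TM PM TR PR} {σM : Schedule TM PM} {σR : Schedule TR PR}
  {σ : MRSchedule TM PM TR PR}

theorem Instance.width_nonneg (hM : I.mapStage.Feasible σM) (j : J) : 0 ≤ I.width σM σR j :=
  (hM.jobCompletion_nonneg j).trans (le_max_left _ _)

/-- Every job has a Reduce task, and it starts only after all Map tasks of the job. -/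
theorem Instance.Feasible.map_cost_le [Fintype J] {τ : MRSchedule TM PM TR PR} (h : I.Feasible τ) :
    I.mapStage.cost I.weight τ.mapSched ≤ I.cost τ := by
  refine sum_le_sum fun j _ => mul_le_mul_of_nonneg_left ?_ (I.weight_pos j).le
  refine Stage.jobCompletion_le fun m hm => ?_
  obtain ⟨r, hr⟩ := I.reduceStage.job_surjective j
  have h1 := h.2.2 m r (hm.trans hr.symm)
  have h2 := I.reduceStage.completion_le_jobCompletion τ.reduceSched r
  rw [hr] at h2
  have h3 := I.reduceStage.time_pos (τ.reduceSched.proc r) r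
  rw [Stage.completion] at h2
  linarith

variable [DecidableEq TM] [DecidableEq TR] [DecidableEq PM] [DecidableEq PR]

theorem Instance.exists_isMerged (I : Instance J TM PM TR PR) (σM : Schedule TM PM)
    (σR : Schedule TR PR) : ∃ σ, I.IsMerged σM σR σ := by
  obtain ⟨m, hm, hm'⟩ := I.mapStage.exists_dispatched
    (fun k => I.width σM σR (I.mapStage.job k)) (fun _ => 0) σM.proc
  obtain ⟨r, hr, hr'⟩ := I.reduceStage.exists_dispatched
    (fun k => I.width σM σR (I.reduceStage.job k))
    (fun k => I.width σM σR (I.reduceStage.job k)) σR.proc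
  exact ⟨⟨m, r⟩, hm, hr, hm', hr'⟩

/-- Only tasks of no larger width delay `k`; in `σM` they all run on the same processor and end by
the width of `k`, so the volume bound applies. -/
theorem Instance.IsMerged.map_completion_le (h : I.IsMerged σM σR σ)
    (hM : I.mapStage.Feasible σM) (k : TM) :
    I.mapStage.completion σ.mapSched k ≤ I.width σM σR (I.mapStage.job k) := by
  refine (h.2.2.1.completion_le (fun _ _ _ => le_rfl) k).trans ?_
  rw [max_self, zero_add, h.1]
  refine hM.sum_time_le _ (I.width_nonneg hM _) _ (fun k' hk' => (mem_filter.1 hk').2.1)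
    fun k' hk' => ?_
  exact ((I.mapStage.completion_le_jobCompletion σM k').trans (le_max_left _ _)).trans
    (mem_filter.1 hk').2.2

/-- One width is spent until the release, and at most one more on tasks of no larger width, by the
volume bound for `σR`. Priority and release coincide, so the delay bound for dispatching applies. -/
theorem Instance.IsMerged.reduce_completion_le (h : I.IsMerged σM σR σ)
    (hM : I.mapStage.Feasible σM) (hR : I.reduceStage.Feasible σR) (k : TR) :
    I.reduceStage.completion σ.reduceSched k ≤ 2 * I.width σM σR (I.reduceStage.job k) := by
  have h0 := I.width_nonneg (σR := σR) hM (I.reduceStage.job k)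
  have h1 := h.2.2.2.completion_le (fun _ _ => le_of_lt) k
  rw [max_eq_right h0, h.2.1] at h1
  refine h1.trans ?_
  rw [two_mul]
  gcongr
  refine hR.sum_time_le _ h0 _ (fun k' hk' => (mem_filter.1 hk').2.1) fun k' hk' => ?_
  exact ((I.reduceStage.completion_le_jobCompletion σR k').trans (le_max_right _ _)).trans
    (mem_filter.1 hk').2.2

theorem Instance.IsMerged.feasible (h : I.IsMerged σM σR σ) (hM : I.mapStage.Feasible σM) :
    I.Feasible σ := by
  refine ⟨h.2.2.1.feasible, h.2.2.2.feasible, fun m r hmr => ?_⟩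
  have h1 := h.map_completion_le hM m
  rw [hmr] at h1
  exact h1.trans (h.2.2.2.release_le_start r)

theorem Instance.IsMerged.cost_le [Fintype J] (h : I.IsMerged σM σR σ)
    (hM : I.mapStage.Feasible σM) (hR : I.reduceStage.Feasible σR) :
    I.cost σ ≤ 2 * (I.mapStage.cost I.weight σM + I.reduceStage.cost I.weight σR) := by
  rw [Instance.cost, Stage.cost, Stage.cost, ← sum_add_distrib, mul_sum]
  refine sum_le_sum fun j _ => ?_
  have h1 : I.reduceStage.jobCompletion σ.reduceSched j ≤ 2 * I.width σM σR j :=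
    Stage.jobCompletion_le fun k hk => hk ▸ h.reduce_completion_le hM hR k
  have h2 : I.width σM σR j ≤ I.mapStage.jobCompletion σM j + I.reduceStage.jobCompletion σR j :=
    max_le_add_of_nonneg (hM.jobCompletion_nonneg j) (hR.jobCompletion_nonneg j)
  have h3 := mul_le_mul_of_nonneg_left
    (h1.trans (mul_le_mul_of_nonneg_left h2 zero_le_two)) (I.weight_pos j).le
  linarith

end Merge

/-! ### Geometric intervals -/

section Endpoints

theorem endpoint_eq (u : ℝ) (ℓ : ℕ) : endpoint u ℓ = u * (3 / 2) ^ ℓ := by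
  norm_num [endpoint, delta]

theorem endpoint_zero (u : ℝ) : endpoint u 0 = u := by simp [endpoint]

theorem endpoint_succ (u : ℝ) (ℓ : ℕ) : endpoint u (ℓ + 1) = 3 / 2 * endpoint u ℓ := by
  rw [endpoint_eq, endpoint_eq, pow_succ]; ring

theorem endpoint_pos {u : ℝ} (hu : 0 < u) (ℓ : ℕ) : 0 < endpoint u ℓ := by
  rw [endpoint_eq]; positivity

theorem endpoint_mono {u : ℝ} (hu : 0 < u) : Monotone (endpoint u) :=
  monotone_nat_of_le_succ fun ℓ => by
    rw [endpoint_succ]; linarith [endpoint_pos hu ℓ]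

theorem exists_le_endpoint {u : ℝ} (hu : 0 < u) (b : ℝ) : ∃ ℓ, b ≤ endpoint u ℓ := by
  obtain ⟨n, hn⟩ := pow_unbounded_of_one_lt (b / u) (by norm_num : (1 : ℝ) < 3 / 2)
  exact ⟨n, by rw [endpoint_eq]; exact ((div_lt_iff₀' hu).1 hn).le⟩

/-- The lengths of the first `ℓ` intervals sum up to at most three times the last one. -/
theorem sum_endpoint_le {u : ℝ} (hu : 0 < u) (ℓ : ℕ) :
    ∑ t ∈ Icc 1 ℓ, endpoint u t ≤ 3 * endpoint u ℓ := by
  induction ℓ with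
  | zero => simpa using (endpoint_pos hu 0).le
  | succ ℓ ih =>
    -- The constant 3 = (1 + δ)/δ is preserved: 3 + 3/2 = 3 · 3/2.
    rw [sum_Icc_succ_top (by omega), endpoint_succ]
    linarith

/-- Every value between the first and the last end point lies in some interval. -/
theorem exists_interval {u b : ℝ} {L : ℕ} (hL : 1 ≤ L) (hlo : u ≤ b) (hhi : b ≤ endpoint u L) :
    ∃ ℓ ∈ Icc 1 L, endpoint u (ℓ - 1) ≤ b ∧ b ≤ endpoint u ℓ := by
  induction L, hL using Nat.le_induction with
  | base => exact ⟨1, by simp, by simpa [endpoint_zero] using hlo, hhi⟩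
  | succ L hL ih =>
    rcases le_total b (endpoint u L) with h | h
    · obtain ⟨ℓ, hℓ, h'⟩ := ih h
      rw [mem_Icc] at hℓ
      exact ⟨ℓ, mem_Icc.2 ⟨hℓ.1, by omega⟩, h'⟩
    · exact ⟨L + 1, by simp, by simpa using h, hhi⟩

end Endpoints

/-! ### The linear program as a relaxation -/

section LinearProgram

variable {J T P : Type*} [Fintype T] [Fintype P] {S : Stage J T P}

/-- An integral assignment of the tasks to assignessors and intervals that respects the load
constraints is a solution of the linear program. -/
theorem Stage.lpFeasible_of_assignment [DecidableEq P] {u : ℝ} {L : ℕ} {assign : T → P}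
    {lev : T → ℕ} {compl : T → ℝ} {jobCompl : J → ℝ} (hlev : ∀ k, lev k ∈ Icc 1 L)
    (hD : ∀ k, compl k ≤ jobCompl (S.job k))
    (hC : ∀ k, endpoint u (lev k - 1) ≤ compl k)
    (hload : ∀ i, ∀ ℓ ∈ Icc 1 L,
      ∑ k ∈ univ.filter (fun k => assign k = i ∧ lev k ≤ ℓ), S.time i k ≤ endpoint u ℓ)
    (hlong : ∀ k, S.time (assign k) k ≤ endpoint u (lev k)) :
    S.LPFeasible u L ⟨fun i k ℓ => if assign k = i ∧ lev k = ℓ then 1 else 0, compl, jobCompl⟩ where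
  covered k := by
    have h : ∀ i, ∑ ℓ ∈ Icc 1 L, (if assign k = i ∧ lev k = ℓ then (1 : ℝ) else 0) =
        if assign k = i then 1 else 0 := fun i => by
      by_cases hi : assign k = i
      · simp only [hi, true_and, sum_ite_eq, if_pos (hlev k), if_true]
      · simp [hi]
    simp [h]
  dummy_last := hD
  completion_ge k := by
    have h : ∀ i, ∑ ℓ ∈ Icc 1 L, endpoint u (ℓ - 1) *
        (if assign k = i ∧ lev k = ℓ then (1 : ℝ) else 0) =
        if assign k = i then endpoint u (lev k - 1) else 0 := fun i => by
      by_cases hi : assign k = i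
      · simp only [hi, true_and, mul_ite, mul_one, mul_zero, sum_ite_eq, if_pos (hlev k), if_true]
      · simp [hi]
    simp only [h, sum_ite_eq, mem_univ, if_true]
    exact hC k
  load_le i ℓ hℓ := by
    refine le_of_eq_of_le ?_ (hload i ℓ hℓ)
    rw [sum_filter]
    refine sum_congr rfl fun k _ => ?_
    have hk := (mem_Icc.1 (hlev k)).1
    by_cases hi : assign k = i
    · simp only [hi, true_and, sum_ite_eq, mem_Icc, hk, mul_ite, mul_one, mul_zero]
    · simp [hi]
  too_long i k ℓ hℓ h := by
    dsimp only
    rw [if_neg]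
    rintro ⟨rfl, rfl⟩
    exact absurd (hlong k) (not_le.2 h)
  nonneg i k ℓ hℓ := by
    dsimp only
    split_ifs <;> norm_num

variable [Nonempty P] (S)

theorem Stage.numIntervals_spec {u : ℝ} (hu : 0 < u) :
    1 ≤ S.numIntervals u ∧ S.horizon ≤ endpoint u (S.numIntervals u - 1) := by
  obtain ⟨n, hn⟩ := exists_le_endpoint hu S.horizon
  have hne : {L : ℕ | 1 ≤ L ∧ S.horizon ≤ endpoint u (L - 1)}.Nonempty :=
    ⟨n + 1, by simp, by simpa using hn⟩
  exact Nat.sInf_mem hne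

theorem Stage.horizon_le_endpoint {u : ℝ} (hu : 0 < u) :
    S.horizon ≤ endpoint u (S.numIntervals u) :=
  (S.numIntervals_spec hu).2.trans (endpoint_mono hu (Nat.sub_le _ _))

theorem Stage.sum_time_le_horizon (proc : T → P) (A : Finset T) :
    ∑ k ∈ A, S.time (proc k) k ≤ S.horizon :=
  (sum_le_univ_sum_of_nonneg fun k => (S.time_pos _ k).le).trans <|
    sum_le_sum fun k _ => le_sup' (fun i => S.time i k) (mem_univ (proc k))

theorem Stage.time_le_horizon (i : P) (k : T) : S.time i k ≤ S.horizon := by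
  simpa using S.sum_time_le_horizon (fun _ => i) {k}

variable {S}

/-- Everything goes to one processor in the last interval, where the horizon bounds the load. -/
theorem Stage.exists_lpFeasible (S : Stage J T P) {u : ℝ} (hu : 0 < u) :
    ∃ x, S.LPFeasible u (S.numIntervals u) x := by
  classical
  obtain ⟨hL, -⟩ := S.numIntervals_spec hu
  refine ⟨_, Stage.lpFeasible_of_assignment (assign := fun _ => Classical.arbitrary P)
    (lev := fun _ => S.numIntervals u) (compl := fun _ => endpoint u (S.numIntervals u - 1))
    (jobCompl := fun _ => endpoint u (S.numIntervals u - 1)) (fun k => by simp [hL])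
    (fun _ => le_rfl)
    (fun _ => le_rfl) (fun i ℓ hℓ => ?_)
    fun k => (S.time_le_horizon _ k).trans (S.horizon_le_endpoint hu)⟩
  by_cases h : S.numIntervals u ≤ ℓ
  · exact ((S.sum_time_le_horizon (fun _ => i) _).trans (S.horizon_le_endpoint hu)).trans
      (endpoint_mono hu h)
  · simpa [h] using (endpoint_pos hu ℓ).le

/-- The completion times of a feasible schedule are part of a solution of the linear program. -/
theorem Stage.Feasible.exists_lpFeasible [DecidableEq J] {u : ℝ} (hu : 0 < u)
    (huS : ∀ i k, u ≤ S.time i k) {τ : Schedule T P} (h : S.Feasible τ) :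
    ∃ x : LPPoint J T P, S.LPFeasible u (S.numIntervals u) x ∧ x.D = S.jobCompletion τ := by
  classical
  obtain ⟨hL, hhor⟩ := S.numIntervals_spec hu
  have hle : ∀ k, S.time (τ.proc k) k ≤ S.completion τ k := fun k => by
    rw [Stage.completion]; linarith [h.1 k]
  -- A schedule with idle time may run past the last end point. Such tasks go to interval `L`, whose
  -- load constraint holds by the horizon alone. The bound `u ≤ S.time i k` keeps completions from
  -- preceding the first interval.
  have hlev : ∀ k, ∃ ℓ ∈ Icc 1 (S.numIntervals u), endpoint u (ℓ - 1) ≤ S.completion τ k ∧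
      (S.completion τ k ≤ endpoint u ℓ ∨ ℓ = S.numIntervals u) := fun k => by
    rcases le_total (S.completion τ k) (endpoint u (S.numIntervals u)) with hk | hk
    · obtain ⟨ℓ, h1, h2, h3⟩ := exists_interval hL ((huS _ k).trans (hle k)) hk
      exact ⟨ℓ, h1, h2, .inl h3⟩
    · exact ⟨_, by simp [hL], (endpoint_mono hu (Nat.sub_le _ _)).trans hk, .inr rfl⟩
  choose lev h1 h2 h3 using hlev
  refine ⟨_, Stage.lpFeasible_of_assignment (assign := τ.proc) (lev := lev)
    (compl := S.completion τ)
    (jobCompl := S.jobCompletion τ) h1 (S.completion_le_jobCompletion τ) h2 (fun i ℓ hℓ => ?_)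
    fun k => ?_, rfl⟩
  · rcases (mem_Icc.1 hℓ).2.eq_or_lt with rfl | hlt
    · exact (S.sum_time_le_horizon (fun _ => i) _).trans (S.horizon_le_endpoint hu)
    · refine h.sum_time_le i (endpoint_pos hu ℓ).le _ (fun k hk => (mem_filter.1 hk).2.1)
        fun k hk => ?_
      have hk' := (mem_filter.1 hk).2.2
      rcases h3 k with h4 | h4
      · exact h4.trans (endpoint_mono hu hk')
      · omega
  · rcases h3 k with h4 | h4
    · exact (hle k).trans h4
    · rw [h4]
      exact (S.time_le_horizon _ k).trans (S.horizon_le_endpoint hu)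

theorem Stage.LPOptimal.sum_le_cost [Fintype J] [DecidableEq J] {w : J → ℝ} {u : ℝ} (hu : 0 < u)
    (huS : ∀ i k, u ≤ S.time i k) {x : LPPoint J T P} (hx : S.LPOptimal w u x)
    {τ : Schedule T P} (h : S.Feasible τ) : ∑ j, w j * x.D j ≤ S.cost w τ := by
  obtain ⟨x', hx', hD⟩ := h.exists_lpFeasible hu huS
  have := hx.2 x' hx'
  rwa [hD] at this

end LinearProgram

/-! ### Optimal solutions: existence and an upper bound -/

section Existence

variable {J T P : Type*} [Fintype J] [Fintype T] [Fintype P] [Nonempty P]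

/-- For given `y` the least possible `C` and `D` are continuous in `y`, so it remains to minimize a
continuous function over a compact set of `y`. -/
theorem Stage.exists_lpOptimal (S : Stage J T P) {w : J → ℝ} (hw : ∀ j, 0 < w j) {u : ℝ}
    (hu : 0 < u) : ∃ x, S.LPOptimal w u x := by
  classical
  set L := S.numIntervals u with hL
  let C : (P → T → ℕ → ℝ) → T → ℝ := fun y k =>
    ∑ i, ∑ ℓ ∈ Icc 1 L, endpoint u (ℓ - 1) * y i k ℓ
  let D : (P → T → ℕ → ℝ) → J → ℝ := fun y j => (S.tasks j).sup' (S.tasks_nonempty j) (C y)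
  -- The load constraint forces this bound for `1 ≤ ℓ ≤ L`.
  let B : P → T → ℕ → ℝ := fun i k ℓ => endpoint u ℓ / S.time i k
  let F : Set (P → T → ℕ → ℝ) := Set.Icc 0 B ∩
    ({y | ∀ k, 1 ≤ ∑ i, ∑ ℓ ∈ Icc 1 L, y i k ℓ} ∩
    ({y | ∀ i, ∀ ℓ ∈ Icc 1 L, ∑ k, S.time i k * ∑ t ∈ Icc 1 ℓ, y i k t ≤ endpoint u ℓ} ∩
    {y | ∀ i k, ∀ ℓ ∈ Icc 1 L, endpoint u ℓ < S.time i k → y i k ℓ = 0}))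
  have hF : ∀ y ∈ F, S.LPFeasible u L ⟨y, C y, D y⟩ := fun y hy =>
    { covered := hy.2.1
      dummy_last := fun k => le_sup' (C y) (by simp [Stage.tasks])
      completion_ge := fun k => le_rfl
      load_le := hy.2.2.1
      too_long := hy.2.2.2
      nonneg := fun i k ℓ _ => hy.1.1 i k ℓ }
  have hcomp : IsCompact F := by
    refine isCompact_Icc.inter_right (.inter ?_ (.inter ?_ ?_))
    · simp only [Set.ofPred_forall]
      exact isClosed_iInter fun k => isClosed_le (by fun_prop) (by fun_prop)
    · simp only [Set.ofPred_forall]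
      exact isClosed_iInter fun i => isClosed_iInter fun ℓ => isClosed_iInter fun _ =>
        isClosed_le (by fun_prop) (by fun_prop)
    · simp only [Set.ofPred_forall]
      exact isClosed_iInter fun i => isClosed_iInter fun k => isClosed_iInter fun ℓ =>
        isClosed_iInter fun _ => isClosed_iInter fun _ => isClosed_eq (by fun_prop) (by fun_prop)
  -- every solution is dominated by one in the compact set
  have hdom : ∀ x, S.LPFeasible u L x → ∃ y ∈ F, ∀ j, D y j ≤ x.D j := fun x hx => by
    -- Values outside `1 ≤ ℓ ≤ L` are unconstrained and may violate the bounds, so they are reset to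
    -- zero.
    let y : P → T → ℕ → ℝ := fun i k ℓ => if ℓ ∈ Icc 1 L then x.y i k ℓ else 0
    have hy : ∀ i k, ∀ ℓ ∈ Icc 1 L, y i k ℓ = x.y i k ℓ := fun i k ℓ hℓ => if_pos hℓ
    have hpart : ∀ i k, ∀ ℓ ∈ Icc 1 L, ∑ t ∈ Icc 1 ℓ, y i k t = ∑ t ∈ Icc 1 ℓ, x.y i k t :=
      fun i k ℓ hℓ => sum_congr rfl fun t ht => hy i k t <| by
        rw [mem_Icc] at *; omega
    have hy0 : ∀ i k ℓ, 0 ≤ y i k ℓ := fun i k ℓ => by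
      by_cases hℓ : ℓ ∈ Icc 1 L
      · rw [hy i k ℓ hℓ]; exact hx.nonneg i k ℓ hℓ
      · exact (if_neg hℓ).ge
    have hload : ∀ i, ∀ ℓ ∈ Icc 1 L,
        ∑ k, S.time i k * ∑ t ∈ Icc 1 ℓ, y i k t ≤ endpoint u ℓ := fun i ℓ hℓ => by
      simpa only [hpart i _ ℓ hℓ] using hx.load_le i ℓ hℓ
    refine ⟨y, ⟨⟨hy0, fun i k ℓ => ?_⟩, fun k => ?_, hload, fun i k ℓ hℓ h => ?_⟩, fun j => ?_⟩
    · by_cases hℓ : ℓ ∈ Icc 1 L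
      · have hℓ1 := (mem_Icc.1 hℓ).1
        rw [le_div_iff₀' (S.time_pos i k)]
        refine le_trans ?_ (hload i ℓ hℓ)
        refine le_trans ?_ (single_le_sum (f := fun k => S.time i k * ∑ t ∈ Icc 1 ℓ, y i k t)
          (fun k _ => mul_nonneg (S.time_pos i k).le (sum_nonneg fun t _ => hy0 i k t))
          (mem_univ k))
        exact mul_le_mul_of_nonneg_left (single_le_sum (f := fun t => y i k t)
          (fun t _ => hy0 i k t) (by simp [hℓ1])) (S.time_pos i k).le
      · exact (if_neg hℓ).le.trans (div_nonneg (endpoint_pos hu ℓ).le (S.time_pos i k).le)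
    · refine (hx.covered k).trans (le_of_eq ?_)
      exact sum_congr rfl fun i _ => sum_congr rfl fun ℓ hℓ => (hy i k ℓ hℓ).symm
    · rw [hy i k ℓ hℓ]; exact hx.too_long i k ℓ hℓ h
    · refine sup'_le _ _ fun k hk => ?_
      have hk' : S.job k = j := by simpa [Stage.tasks] using hk
      refine le_trans (le_of_eq_of_le ?_ (hx.completion_ge k)) (hk' ▸ hx.dummy_last k)
      exact sum_congr rfl fun i _ => sum_congr rfl fun ℓ hℓ => by rw [hy i k ℓ hℓ]
  obtain ⟨x₀, hx₀⟩ := S.exists_lpFeasible hu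
  obtain ⟨y₀, hy₀, -⟩ := hdom x₀ hx₀
  have hDc : ∀ j, Continuous fun y => D y j := fun j =>
    Continuous.finset_sup'_apply _ fun k _ => by fun_prop
  obtain ⟨y, hy, hmin⟩ := hcomp.exists_isMinOn ⟨y₀, hy₀⟩
    (f := fun y => ∑ j, w j * D y j) (by fun_prop)
  refine ⟨⟨y, C y, D y⟩, hF y hy, fun x' hx' => ?_⟩
  obtain ⟨y', hy', hle⟩ := hdom x' hx'
  exact (hmin hy').trans (sum_le_sum fun j _ => mul_le_mul_of_nonneg_left (hle j) (hw j).le)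

variable {S : Stage J T P}

/-- In an optimal solution no task completes, fractionally, after the last but one end point:
otherwise capping the completion times and scaling down the assignment would improve it. -/
theorem Stage.LPOptimal.D_le {w : J → ℝ} (hw : ∀ j, 0 < w j) {u : ℝ} (hu : 0 < u)
    {x : LPPoint J T P} (hx : S.LPOptimal w u x) (j : J) :
    x.D j ≤ endpoint u (S.numIntervals u - 1) := by
  set L := S.numIntervals u with hL
  set b := endpoint u (L - 1) with hb
  have hf := hx.1
  -- Division by the total mass turns the left side of `completion_ge` into a weighted mean of end
  -- points that are at most `b`, so the cap at `b` is feasible.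
  let Y : T → ℝ := fun k => ∑ i, ∑ ℓ ∈ Icc 1 L, x.y i k ℓ
  have hY : ∀ k, 1 ≤ Y k := hf.covered
  have hY0 : ∀ k, 0 < Y k := fun k => one_pos.trans_le (hY k)
  have hscale : ∀ i k, ∀ ℓ ∈ Icc 1 L, x.y i k ℓ / Y k ≤ x.y i k ℓ := fun i k ℓ hℓ =>
    div_le_self (hf.nonneg i k ℓ hℓ) (hY k)
  have hx' : S.LPFeasible u L
      ⟨fun i k ℓ => x.y i k ℓ / Y k, fun k => min (x.C k) b, fun j => min (x.D j) b⟩ :=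
    { covered := fun k => by
        simp only [← sum_div]
        exact (div_self (hY0 k).ne').ge
      dummy_last := fun k => min_le_min_right _ (hf.dummy_last k)
      completion_ge := fun k => by
        refine le_min (le_trans ?_ (hf.completion_ge k)) ?_
        · exact sum_le_sum fun i _ => sum_le_sum fun ℓ hℓ =>
            mul_le_mul_of_nonneg_left (hscale i k ℓ hℓ) (endpoint_pos hu _).le
        · calc ∑ i, ∑ ℓ ∈ Icc 1 L, endpoint u (ℓ - 1) * (x.y i k ℓ / Y k)
              ≤ ∑ i, ∑ ℓ ∈ Icc 1 L, b * (x.y i k ℓ / Y k) :=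
                sum_le_sum fun i _ => sum_le_sum fun ℓ hℓ =>
                  mul_le_mul_of_nonneg_right
                    (endpoint_mono hu (Nat.sub_le_sub_right (mem_Icc.1 hℓ).2 1))
                    (div_nonneg (hf.nonneg i k ℓ hℓ) (hY0 k).le)
            _ = b := by
                simp only [← mul_sum, ← sum_div]
                exact (congrArg (b * ·) (div_self (hY0 k).ne')).trans (mul_one b)
      load_le := fun i ℓ hℓ => by
        refine le_trans (sum_le_sum fun k _ => mul_le_mul_of_nonneg_left
          (sum_le_sum fun t ht => hscale i k t ?_) (S.time_pos i k).le) (hf.load_le i ℓ hℓ)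
        rw [mem_Icc] at *; omega
      too_long := fun i k ℓ hℓ h => by simp [hf.too_long i k ℓ hℓ h]
      nonneg := fun i k ℓ hℓ => div_nonneg (hf.nonneg i k ℓ hℓ) (hY0 k).le }
  by_contra hlt
  push Not at hlt
  refine absurd (hx.2 _ hx') (not_le.2 ?_)
  exact sum_lt_sum (fun j _ => mul_le_mul_of_nonneg_left (min_le_left _ _) (hw j).le)
    ⟨j, mem_univ j, mul_lt_mul_of_pos_left (min_lt_iff.2 (.inr hlt)) (hw j)⟩

end Existence

/-! ### Classes and truncation -/

section Classes

theorem truncated_eq {T P : Type*} (y : P → T → ℕ → ℝ) (cls : T → ℕ) (i : P) (k : T) :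
    truncated y cls i k = 3 * ∑ t ∈ Icc 1 (cls k), y i k t := by
  norm_num [truncated, slack]

variable {J T P : Type*} [Fintype T] [Fintype P] {S : Stage J T P} {u : ℝ} {L : ℕ}
  {x : LPPoint J T P}

theorem Stage.LPFeasible.le_C (hu : 0 < u) (hx : S.LPFeasible u L x) (k : T) : u ≤ x.C k := by
  refine le_trans ?_ (hx.completion_ge k)
  calc u ≤ u * ∑ i, ∑ ℓ ∈ Icc 1 L, x.y i k ℓ := le_mul_of_one_le_right hu.le (hx.covered k)
    _ ≤ _ := by
      simp only [mul_sum]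
      refine sum_le_sum fun i _ => sum_le_sum fun ℓ hℓ =>
        mul_le_mul_of_nonneg_right ?_ (hx.nonneg i k ℓ hℓ)
      simpa only [endpoint_zero] using endpoint_mono hu (Nat.zero_le (ℓ - 1))

/-- Since a = 1 + δ, the bound `D_le` by the last but one end point puts `slack * x.C k` below the
last one. -/
theorem Stage.LPOptimal.exists_classification [Fintype J] [Nonempty P] {w : J → ℝ}
    (hw : ∀ j, 0 < w j) (hu : 0 < u) (hx : S.LPOptimal w u x) :
    ∃ cls : T → ℕ, IsClassification u (S.numIntervals u) x.C cls := by
  obtain ⟨hL, -⟩ := S.numIntervals_spec hu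
  have h : ∀ k, ∃ ℓ ∈ Icc 1 (S.numIntervals u),
      endpoint u (ℓ - 1) ≤ slack * x.C k ∧ slack * x.C k ≤ endpoint u ℓ := fun k => by
    have h1 := hx.1.le_C hu k
    have h2 := (hx.1.dummy_last k).trans (hx.D_le hw hu (S.job k))
    have h3 := endpoint_succ u (S.numIntervals u - 1)
    rw [Nat.sub_add_cancel hL] at h3
    refine exists_interval hL ?_ ?_ <;> rw [slack] <;> linarith
  choose cls h1 h2 using h
  exact ⟨cls, fun k => ⟨h1 k, h2 k⟩⟩

variable {cls : T → ℕ}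

theorem Stage.LPFeasible.truncated_nonneg (hx : S.LPFeasible u L x)
    (hcls : IsClassification u L x.C cls) (i : P) (k : T) : 0 ≤ truncated x.y cls i k := by
  rw [truncated_eq]
  refine mul_nonneg zero_le_three (sum_nonneg fun t ht => hx.nonneg i k t ?_)
  have := mem_Icc.1 (hcls k).1
  rw [mem_Icc] at *; omega

/-- At least the fraction `(a - 1) / a` of a task is completed in the intervals up to its class. -/
theorem Stage.LPFeasible.one_le_sum_truncated (hu : 0 < u) (hx : S.LPFeasible u L x)
    (hcls : IsClassification u L x.C cls) (k : T) : 1 ≤ ∑ i, truncated x.y cls i k := by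
  obtain ⟨hk, -, hhi⟩ := hcls k
  rw [mem_Icc] at hk
  set b := endpoint u (cls k) with hb
  have hb0 : 0 < b := endpoint_pos hu _
  -- Markov: each unit of mass beyond the class contributes at least `b` to the fractional
  -- completion time.
  have hsplit : ∀ i, b * ∑ ℓ ∈ Icc 1 L, x.y i k ℓ ≤
      ∑ ℓ ∈ Icc 1 L, endpoint u (ℓ - 1) * x.y i k ℓ +
        b * ∑ t ∈ Icc 1 (cls k), x.y i k t := fun i => by
    have h1 : Icc 1 (cls k) = (Icc 1 L).filter fun ℓ => ℓ ≤ cls k := by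
      ext ℓ; simp only [mem_filter, mem_Icc]; omega
    rw [h1, sum_filter, mul_sum, mul_sum, ← sum_add_distrib]
    refine sum_le_sum fun ℓ hℓ => ?_
    have hy := hx.nonneg i k ℓ hℓ
    split_ifs with hle
    · exact le_add_of_nonneg_left (mul_nonneg (endpoint_pos hu _).le hy)
    · rw [mul_zero, add_zero]
      exact mul_le_mul_of_nonneg_right (endpoint_mono hu (by omega)) hy
  have hsum := sum_le_sum fun i (_ : i ∈ (univ : Finset P)) => hsplit i
  rw [sum_add_distrib, ← mul_sum, ← mul_sum] at hsum
  simp only [truncated_eq, ← mul_sum]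
  have h1 := mul_le_mul_of_nonneg_left (hx.covered k) hb0.le
  have h2 := hx.completion_ge k
  rw [slack] at hhi
  -- The mass beyond the class is at most `x.C k / b ≤ 2/3`, so at least 1/3 is kept.
  have h3 : b * 1 ≤ b * (3 * ∑ i, ∑ t ∈ Icc 1 (cls k), x.y i k t) := by linarith
  exact le_of_mul_le_mul_left h3 hb0

end Classes

/-- A fractional matching that covers every `k : T` yields a matching along its support. -/
theorem exists_matching_of_fractional {T Q : Type*} [Fintype T] (s : Finset Q) (W : T → Q → ℝ)
    (hW : ∀ k q, 0 ≤ W k q) (hT : ∀ k, 1 ≤ ∑ q ∈ s, W k q) (hQ : ∀ q ∈ s, ∑ k, W k q ≤ 1) :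
    ∃ f : T → Q, Function.Injective f ∧ ∀ k, f k ∈ s ∧ 0 < W k (f k) := by
  classical
  -- Hall's condition by double counting: the tasks of `A` have weight at least `#A`, all of it on
  -- neighbours that carry at most one each.
  obtain ⟨f, hf, hft⟩ := (all_card_le_biUnion_card_iff_exists_injective
    fun k => s.filter fun q => 0 < W k q).1 fun A => by
      have hsub : A.biUnion (fun k => s.filter fun q => 0 < W k q) ⊆ s :=
        biUnion_subset.2 fun k _ => filter_subset _ _
      have h : (#A : ℝ) ≤ #(A.biUnion fun k => s.filter fun q => 0 < W k q) := by
        calc (#A : ℝ) = ∑ k ∈ A, 1 := by simp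
          _ ≤ ∑ k ∈ A, ∑ q ∈ s, W k q := sum_le_sum fun k _ => hT k
          _ = ∑ k ∈ A, ∑ q ∈ A.biUnion (fun k => s.filter fun q => 0 < W k q), W k q := by
            refine sum_congr rfl fun k hk => (sum_subset hsub fun q hq hq' => ?_).symm
            by_contra hne
            exact hq' (mem_biUnion.2
              ⟨k, hk, mem_filter.2 ⟨hq, (hW k q).lt_of_ne (Ne.symm hne)⟩⟩)
          _ = ∑ q ∈ A.biUnion (fun k => s.filter fun q => 0 < W k q), ∑ k ∈ A, W k q := sum_comm
          _ ≤ ∑ q ∈ A.biUnion (fun k => s.filter fun q => 0 < W k q), 1 :=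
            sum_le_sum fun q hq =>
              (sum_le_univ_sum_of_nonneg fun k => hW k q).trans (hQ q (hsub hq))
          _ = _ := by simp
      exact_mod_cast h
  exact ⟨f, hf, fun k => mem_filter.1 (hft k)⟩

/-! ### Slots of the Shmoys–Tardos layout -/

section Clamp

/-- The length of the part of the interval `(0, t)` that lies in the unit interval. -/
noncomputable def unitClamp (t : ℝ) : ℝ := max 0 (min t 1)

theorem unitClamp_mono : Monotone unitClamp := fun _ _ h =>
  max_le_max le_rfl (min_le_min_right _ h)

theorem unitClamp_nonneg (t : ℝ) : 0 ≤ unitClamp t := le_max_left _ _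

theorem unitClamp_le_one (t : ℝ) : unitClamp t ≤ 1 := max_le zero_le_one (min_le_right _ _)

theorem unitClamp_of_nonpos {t : ℝ} (h : t ≤ 0) : unitClamp t = 0 :=
  max_eq_left ((min_le_left _ _).trans h)

theorem unitClamp_of_one_le {t : ℝ} (h : 1 ≤ t) : unitClamp t = 1 := by
  rw [unitClamp, min_eq_right h, max_eq_right zero_le_one]

theorem sum_unitClamp (N : ℕ) (t : ℝ) :
    ∑ s ∈ range N, unitClamp (t - s) = max 0 (min t N) := by
  induction N with
  | zero => simp
  | succ N ih =>
    have hN : (0 : ℝ) ≤ N := N.cast_nonneg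
    rw [sum_range_succ, ih, unitClamp]
    push_cast
    rcases le_total t 0 with h0 | h0
    · rw [min_eq_left (by linarith : t ≤ N), min_eq_left (by linarith : t - N ≤ 1),
        min_eq_left (by linarith : t ≤ N + 1), max_eq_left h0,
        max_eq_left (by linarith : t - N ≤ 0), add_zero]
    rcases le_total t N with h1 | h1
    · rw [min_eq_left h1, min_eq_left (by linarith : t - N ≤ 1),
        min_eq_left (by linarith : t ≤ N + 1),
        max_eq_left (by linarith : t - N ≤ 0), add_zero]
    rcases le_total t (N + 1) with h2 | h2
    · rw [min_eq_right h1, min_eq_left (by linarith : t - N ≤ 1), min_eq_left h2,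
        max_eq_right hN, max_eq_right (by linarith : 0 ≤ t - N), max_eq_right h0]
      ring
    · rw [min_eq_right h1, min_eq_right (by linarith : 1 ≤ t - N), min_eq_right h2,
        max_eq_right hN, max_eq_right zero_le_one, max_eq_right (by linarith)]

/-- If the amounts `x k` are laid out one after another in the order given by `rank`, then the
increments of a function over all of them telescope. -/
theorem sum_layout_telescope {T : Type*} [DecidableEq T] (g : ℝ → ℝ) (x : T → ℝ) (rank : T → ℕ)
    (hrank : Function.Injective rank) (A : Finset T) :
    ∑ k ∈ A, (g (∑ k' ∈ A.filter (fun k' => rank k' < rank k), x k' + x k) -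
      g (∑ k' ∈ A.filter (fun k' => rank k' < rank k), x k')) = g (∑ k ∈ A, x k) - g 0 := by
  induction A using Finset.induction_on_max_value rank with
  | empty => simp
  | insert a A ha hmax ih =>
    have h1 : (insert a A).filter (fun k' => rank k' < rank a) = A := by
      rw [filter_insert, if_neg (lt_irrefl _), filter_true_of_mem]
      exact fun k hk => (hmax k hk).lt_of_ne fun e => ha (hrank e ▸ hk)
    have h2 : ∀ k ∈ A, (insert a A).filter (fun k' => rank k' < rank k) =
        A.filter (fun k' => rank k' < rank k) := fun k hk => by
      rw [filter_insert, if_neg (not_lt.2 (hmax k hk))]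
    have h3 : ∑ k ∈ A, (g (∑ k' ∈ (insert a A).filter (fun k' => rank k' < rank k), x k' + x k) -
        g (∑ k' ∈ (insert a A).filter (fun k' => rank k' < rank k), x k')) =
          g (∑ k ∈ A, x k) - g 0 := by
      rw [← ih]
      exact sum_congr rfl fun k hk => by rw [h2 k hk]
    rw [sum_insert ha, h1, sum_insert ha, h3, add_comm (x a)]
    ring

end Clamp

section Overlap

variable {T P : Type*} [Fintype T] {x : P → T → ℝ} {cls : T → ℕ} {rank : P → T → ℕ}

/-- The length of the part of the amount of task `k` on processor `i` that lies in slot `s`. -/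
noncomputable def overlap (x : P → T → ℝ) (cls : T → ℕ) (rank : P → T → ℕ) (i : P) (k : T)
    (s : ℕ) : ℝ :=
  unitClamp (amountBefore x cls rank i k + x i k - s) -
    unitClamp (amountBefore x cls rank i k - s)

theorem amountBefore_nonneg (hx : ∀ i k, 0 ≤ x i k) (i : P) (k : T) :
    0 ≤ amountBefore x cls rank i k :=
  sum_nonneg fun k' _ => hx i k'

theorem overlap_nonneg (hx : ∀ i k, 0 ≤ x i k) (i : P) (k : T) (s : ℕ) :
    0 ≤ overlap x cls rank i k s :=
  sub_nonneg.2 (unitClamp_mono (by linarith [hx i k]))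

/-- Supplies the adjacency condition of `IsSlotRounding`. -/
theorem adjacent_of_overlap_pos {i : P} {k : T} {s : ℕ} (h : 0 < overlap x cls rank i k s) :
    0 < x i k ∧ amountBefore x cls rank i k < s + 1 ∧
      (s : ℝ) < amountBefore x cls rank i k + x i k := by
  rw [overlap, sub_pos] at h
  refine ⟨?_, ?_, ?_⟩ <;> by_contra hcon <;> push Not at hcon <;> refine absurd h (not_lt.2 ?_)
  · exact unitClamp_mono (by linarith)
  · rw [unitClamp_of_one_le (t := amountBefore x cls rank i k - s) (by linarith)]
    exact unitClamp_le_one _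
  · rw [unitClamp_of_nonpos (by linarith)]
    exact unitClamp_nonneg _

theorem sum_overlap_le (hx : ∀ i k, 0 ≤ x i k) (i : P) (k : T) (N : ℕ) :
    ∑ s ∈ range N, overlap x cls rank i k s ≤ x i k := by
  have hb := amountBefore_nonneg (cls := cls) (rank := rank) hx i k
  simp only [overlap, sum_sub_distrib, sum_unitClamp]
  have h := hx i k
  have hN : (0 : ℝ) ≤ N := N.cast_nonneg
  rw [max_eq_right (le_min hb hN), max_eq_right (le_min (by linarith) hN)]
  rcases le_total (amountBefore x cls rank i k) N with h1 | h1
  · rw [min_eq_left h1]; linarith [min_le_left (amountBefore x cls rank i k + x i k) (N : ℝ)]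
  · rw [min_eq_right h1]; linarith [min_le_right (amountBefore x cls rank i k + x i k) (N : ℝ)]

variable [DecidableEq T]

theorem amountBefore_add_le (hx : ∀ i k, 0 ≤ x i k) (i : P) (k : T) :
    amountBefore x cls rank i k + x i k ≤
      ∑ k' ∈ univ.filter (fun k' => cls k' = cls k), x i k' := by
  rw [amountBefore, add_comm, ← sum_insert (by simp)]
  refine sum_le_sum_of_subset_of_nonneg (insert_subset (by simp) fun k' hk' => ?_)
    fun k' _ _ => hx i k'
  simp only [mem_filter, mem_univ, true_and] at hk' ⊢
  exact hk'.1

theorem sum_overlap_eq (hx : ∀ i k, 0 ≤ x i k) (i : P) (k : T) {N : ℕ}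
    (hN : ∑ k', x i k' ≤ N) : ∑ s ∈ range N, overlap x cls rank i k s = x i k := by
  have hb := amountBefore_nonneg (cls := cls) (rank := rank) hx i k
  have h := hx i k
  have h1 : amountBefore x cls rank i k + x i k ≤ N :=
    (amountBefore_add_le hx i k).trans
      ((sum_le_univ_sum_of_nonneg fun k' => hx i k').trans hN)
  simp only [overlap, sum_sub_distrib, sum_unitClamp]
  rw [min_eq_left h1, min_eq_left (by linarith), max_eq_right hb, max_eq_right (by linarith)]
  ring

/-- The amounts of a class abut, so their overlaps with a slot telescope. The result shows both that
a slot holds at most one unit and when it is full. -/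
theorem sum_overlap_class (hrank : ∀ i, Function.Injective (rank i)) (i : P) (c s : ℕ) :
    ∑ k ∈ univ.filter (fun k => cls k = c), overlap x cls rank i k s =
      unitClamp (∑ k ∈ univ.filter (fun k => cls k = c), x i k - s) := by
  have h := sum_layout_telescope (fun t => unitClamp (t - s)) (x i) (rank i) (hrank i)
    (univ.filter fun k => cls k = c)
  simp only [zero_sub, unitClamp_of_nonpos (neg_nonpos.2 (Nat.cast_nonneg s)), sub_zero] at h
  rw [← h]
  refine sum_congr rfl fun k hk => ?_
  rw [overlap, amountBefore, filter_filter, (mem_filter.1 hk).2]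

/-- A rounding exists if every task has total amount at least one. -/
theorem exists_slotRounding [Fintype P] (hx : ∀ i k, 0 ≤ x i k) (hcov : ∀ k, 1 ≤ ∑ i, x i k)
    (hrank : ∀ i, Function.Injective (rank i)) : ∃ proc, IsSlotRounding x cls rank proc := by
  obtain ⟨N, hN⟩ := exists_nat_ge (∑ i, ∑ k, x i k)
  have hNi : ∀ i, ∑ k, x i k ≤ N := fun i =>
    (single_le_sum (f := fun i => ∑ k, x i k) (fun i _ => sum_nonneg fun k _ => hx i k)
      (mem_univ i)).trans hN
  -- Slots are indexed by class, processor and number, so a single matching rounds all classes at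
  -- once.
  let W : T → ℕ × P × ℕ → ℝ := fun k q =>
    if cls k = q.1 then overlap x cls rank q.2.1 k q.2.2 else 0
  have hW : ∀ k q, 0 ≤ W k q := fun k q => by
    dsimp only [W]
    split_ifs
    exacts [overlap_nonneg hx _ _ _, le_rfl]
  have hT : ∀ k, 1 ≤ ∑ q ∈ univ.image cls ×ˢ (univ : Finset P) ×ˢ range N, W k q := fun k => by
    rw [sum_product, sum_eq_single_of_mem (cls k) (by simp) fun c _ hc => by simp [W, hc.symm],
      sum_product]
    refine (hcov k).trans (le_of_eq (sum_congr rfl fun i _ => ?_))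
    simp only [W, if_true]
    exact (sum_overlap_eq hx i k (hNi i)).symm
  have hQ : ∀ q, ∑ k, W k q ≤ 1 := fun q => by
    simp only [W]
    rw [← sum_filter, sum_overlap_class hrank]
    exact unitClamp_le_one _
  obtain ⟨f, hf, hfW⟩ := exists_matching_of_fractional _ W hW hT fun q _ => hQ q
  have hpos : ∀ k, cls k = (f k).1 ∧ 0 < overlap x cls rank (f k).2.1 k (f k).2.2 := fun k => by
    have h := (hfW k).2
    by_cases hc : cls k = (f k).1
    · exact ⟨hc, by simpa only [W, if_pos hc] using h⟩
    · simp only [W, if_neg hc, lt_self_iff_false] at h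
  refine ⟨fun k => (f k).2.1, fun k => (f k).2.2, fun k => adjacent_of_overlap_pos (hpos k).2,
    fun k k' hc hp hs => hf ?_⟩
  exact Prod.ext ((hpos k).1.symm.trans (hc.trans (hpos k').1)) (Prod.ext hp hs)

end Overlap

/-! ### Load after rounding -/

section Load

theorem Stage.exists_isSorting {J T P : Type*} [Fintype T] (S : Stage J T P) :
    ∃ rank, S.IsSorting rank := by
  -- An arbitrary enumeration breaks ties, so that counting smaller keys gives an injective rank.
  let key : P → T → ℝ ×ₗ ℕ := fun i k => toLex (-S.time i k, (Fintype.equivFin T k : ℕ))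
  have hkey : ∀ i, Function.Injective (key i) := fun i k k' h => by
    have h' := congrArg (fun q => (ofLex q).2) h
    exact (Fintype.equivFin T).injective (Fin.ext h')
  let rank : P → T → ℕ := fun i k => #(univ.filter fun k' => key i k' < key i k)
  have hmono : ∀ i k k', key i k < key i k' → rank i k < rank i k' := fun i k k' h => by
    refine card_lt_card ((ssubset_iff_of_subset fun l hl => ?_).2 ⟨k, by simpa using h, by simp⟩)
    simp only [mem_filter, mem_univ, true_and] at hl ⊢
    exact hl.trans h
  refine ⟨rank, fun i => ⟨fun k k' h => ?_, fun k k' h => ?_⟩⟩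
  · rcases lt_trichotomy (key i k) (key i k') with h' | h' | h'
    · exact absurd h (hmono i k k' h').ne
    · exact hkey i h'
    · exact absurd h (hmono i k' k h').ne'
  · have h' : key i k ≤ key i k' := not_lt.1 fun h' => absurd (hmono i k' k h') h.le.not_gt
    have := Prod.Lex.monotone_fst _ _ h'
    exact neg_le_neg_iff.1 this

variable {J T P : Type*} [Fintype T] [DecidableEq T] [DecidableEq P] {S : Stage J T P}
  {x : P → T → ℝ} {cls : T → ℕ} {rank : P → T → ℕ} {proc : T → P}

/-- The Shmoys-Tardos bound: rounding increases the load of a processor by at most the largest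
processing time of a task of the class that is fractionally assigned to it. -/
theorem IsSlotRounding.load_le (h : IsSlotRounding x cls rank proc) (hx : ∀ i k, 0 ≤ x i k)
    (hrank : S.IsSorting rank) (i : P) (c : ℕ) {M : ℝ} (hM0 : 0 ≤ M)
    (hM : ∀ k, cls k = c → 0 < x i k → S.time i k ≤ M) :
    ∑ k ∈ univ.filter (fun k => cls k = c ∧ proc k = i), S.time i k ≤
      M + ∑ k ∈ univ.filter (fun k => cls k = c), S.time i k * x i k := by
  obtain ⟨slot, hslot, hinj⟩ := h
  -- `G` bounds the length of a task by its slot: by `M` in slot 0, and in slot `s + 1` by the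
  -- weighted average length over slot `s`.
  let G : ℕ → ℝ
    | 0 => M
    | s + 1 => ∑ k ∈ univ.filter (fun k => cls k = c), S.time i k * overlap x cls rank i k s
  have hG : ∀ s, 0 ≤ G s
    | 0 => hM0
    | s + 1 => sum_nonneg fun k _ => mul_nonneg (S.time_pos i k).le (overlap_nonneg hx i k s)
  have hle : ∀ k, cls k = c → proc k = i → S.time i k ≤ G (slot k) := fun k hc hi => by
    obtain ⟨h1, h2, h3⟩ := hslot k
    rw [hi] at h1 h2 h3
    rcases hs : slot k with _ | s
    · exact hM k hc h1
    rw [hs] at h2 h3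
    push_cast at h2 h3
    -- The amount of `k` reaches into slot `s + 1`, so the layout fills slot `s`.
    have hfull : ∑ k' ∈ univ.filter (fun k => cls k = c), overlap x cls rank i k' s = 1 := by
      rw [sum_overlap_class fun i => (hrank i).1]
      apply unitClamp_of_one_le
      have := amountBefore_add_le (cls := cls) (rank := rank) hx i k
      rw [hc] at this
      linarith
    calc S.time i k
        = ∑ k' ∈ univ.filter (fun k => cls k = c), S.time i k * overlap x cls rank i k' s := by
          rw [← mul_sum, hfull, mul_one]
      _ ≤ _ := sum_le_sum fun k' hk' => by
          rcases (overlap_nonneg (cls := cls) (rank := rank) hx i k' s).eq_or_lt with h0 | h0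
          · rw [← h0, mul_zero, mul_zero]
          refine mul_le_mul_of_nonneg_right ?_ h0.le
          obtain ⟨-, h4, -⟩ := adjacent_of_overlap_pos h0
          rcases lt_trichotomy (rank i k') (rank i k) with hr | hr | hr
          · exact (hrank i).2 k' k hr
          · rw [(hrank i).1 hr]
          -- The amount of a task ranked after `k` begins where that of `k` has ended, hence beyond
          -- slot `s`.
          · exfalso
            have hk'c : cls k' = cls k := (mem_filter.1 hk').2.trans hc.symm
            have h5 : amountBefore x cls rank i k + x i k ≤ amountBefore x cls rank i k' := by
              rw [amountBefore, amountBefore, add_comm, ← sum_insert (by simp)]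
              refine sum_le_sum_of_subset_of_nonneg (insert_subset (by simp [hk'c, hr])
                fun l hl => ?_) fun l _ _ => hx i l
              simp only [mem_filter, mem_univ, true_and, hk'c] at hl ⊢
              exact ⟨hl.1, hl.2.trans hr⟩
            linarith
  set A := univ.filter (fun k => cls k = c ∧ proc k = i) with hA
  have hmem : ∀ k ∈ A, cls k = c ∧ proc k = i := fun k hk => (mem_filter.1 hk).2
  have hinjA : Set.InjOn slot A := fun k hk k' hk' hs =>
    hinj k k' ((hmem k hk).1.trans (hmem k' hk').1.symm)
      ((hmem k hk).2.trans (hmem k' hk').2.symm) hs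
  calc ∑ k ∈ A, S.time i k
      ≤ ∑ k ∈ A, G (slot k) := sum_le_sum fun k hk => hle k (hmem k hk).1 (hmem k hk).2
    _ = ∑ s ∈ A.image slot, G s := (sum_image hinjA).symm
    _ ≤ ∑ s ∈ range ((A.image slot).sup id + 1), G s := sum_le_sum_of_subset_of_nonneg
        (fun s hs => mem_range.2 (Nat.lt_succ_of_le (le_sup (f := id) hs))) fun s _ _ => hG s
    _ = M + ∑ s ∈ range ((A.image slot).sup id),
          ∑ k ∈ univ.filter (fun k => cls k = c), S.time i k * overlap x cls rank i k s := by
        rw [sum_range_succ', add_comm]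
    _ ≤ _ := by
        rw [sum_comm]
        simp only [← mul_sum]
        gcongr with k hk
        · exact (S.time_pos i k).le
        · exact sum_overlap_le hx i k _

end Load

/-! ### Approximation guarantee of TaskScheduling -/

section TaskScheduling

variable {J T P : Type*} [Fintype T] [Fintype P] [DecidableEq T] [DecidableEq P]
  {S : Stage J T P} {u : ℝ} {x : LPPoint J T P} {σ : Schedule T P}

/-- The tasks of the classes up to `ℓ` that are assigned to one processor have total length at most
`6 * endpoint u ℓ`. -/
theorem sum_classes_le {cls : T → ℕ} {rank : P → T → ℕ} {proc : T → P} {L : ℕ} (hu : 0 < u)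
    (hx : S.LPFeasible u L x) (hcls : IsClassification u L x.C cls) (hrank : S.IsSorting rank)
    (hr : IsSlotRounding (truncated x.y cls) cls rank proc) (i : P) {ℓ : ℕ} (hℓ : ℓ ∈ Icc 1 L) :
    ∑ k ∈ univ.filter (fun k => proc k = i ∧ cls k ≤ ℓ), S.time i k ≤ 6 * endpoint u ℓ := by
  have hℓ' := mem_Icc.1 hℓ
  have hcls1 : ∀ k, 1 ≤ cls k ∧ cls k ≤ L := fun k => mem_Icc.1 (hcls k).1
  have hload : ∀ c ∈ Icc 1 ℓ,
      ∑ k ∈ univ.filter (fun k => cls k = c ∧ proc k = i), S.time i k ≤ endpoint u c +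
        ∑ k ∈ univ.filter (fun k => cls k = c), 3 * (S.time i k * ∑ t ∈ Icc 1 ℓ, x.y i k t) :=
    fun c hc => by
    rw [mem_Icc] at hc
    refine (hr.load_le (hx.truncated_nonneg hcls) hrank i c (endpoint_pos hu c).le
      fun k hk hpos => ?_).trans ?_
    -- A task longer than the end point of its class is barred from all intervals kept by the
    -- truncation.
    · by_contra hlt
      push Not at hlt
      refine hpos.ne' ?_
      rw [truncated_eq, sum_eq_zero, mul_zero]
      intro t ht
      rw [mem_Icc] at ht
      exact hx.too_long i k t (mem_Icc.2 ⟨ht.1, by omega⟩)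
        ((endpoint_mono hu (by omega)).trans_lt hlt)
    · refine add_le_add le_rfl (sum_le_sum fun k hk => ?_)
      rw [(mem_filter.1 hk).2.symm] at hc
      rw [truncated_eq, mul_left_comm]
      refine mul_le_mul_of_nonneg_left (mul_le_mul_of_nonneg_left
        (sum_le_sum_of_subset_of_nonneg (Icc_subset_Icc_right hc.2) fun t ht _ => ?_)
        (S.time_pos i k).le) zero_le_three
      rw [mem_Icc] at ht
      exact hx.nonneg i k t (mem_Icc.2 ⟨ht.1, by omega⟩)
  have hnn : ∀ k, 0 ≤ 3 * (S.time i k * ∑ t ∈ Icc 1 ℓ, x.y i k t) := fun k =>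
    mul_nonneg zero_le_three (mul_nonneg (S.time_pos i k).le (sum_nonneg fun t ht => by
      rw [mem_Icc] at ht
      exact hx.nonneg i k t (mem_Icc.2 ⟨ht.1, by omega⟩)))
  have hmaps : ∀ A : Finset T, (∀ k ∈ A, cls k ≤ ℓ) → ∀ k ∈ A, cls k ∈ Icc 1 ℓ :=
    fun A hA k hk => mem_Icc.2 ⟨(hcls1 k).1, hA k hk⟩
  rw [← sum_fiberwise_of_maps_to (hmaps _ fun k hk => (mem_filter.1 hk).2.2)]
  calc ∑ c ∈ Icc 1 ℓ, ∑ k ∈ (univ.filter fun k => proc k = i ∧ cls k ≤ ℓ).filter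
          (fun k => cls k = c), S.time i k
      = ∑ c ∈ Icc 1 ℓ, ∑ k ∈ univ.filter (fun k => cls k = c ∧ proc k = i), S.time i k := by
        refine sum_congr rfl fun c hc => sum_congr ?_ fun _ _ => rfl
        ext k
        simp only [mem_filter, mem_univ, true_and, mem_Icc] at hc ⊢
        constructor
        · rintro ⟨⟨h1, -⟩, h2⟩; exact ⟨h2, h1⟩
        · rintro ⟨h1, h2⟩; exact ⟨⟨h2, by omega⟩, h1⟩
    _ ≤ _ := sum_le_sum hload
    _ = ∑ c ∈ Icc 1 ℓ, endpoint u c + ∑ k ∈ univ.filter (fun k => cls k ≤ ℓ),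
          3 * (S.time i k * ∑ t ∈ Icc 1 ℓ, x.y i k t) := by
        rw [sum_add_distrib, ← sum_fiberwise_of_maps_to (hmaps _ fun k hk => (mem_filter.1 hk).2)]
        congr 1
        refine sum_congr rfl fun c hc => sum_congr ?_ fun _ _ => rfl
        ext k
        simp only [mem_filter, mem_univ, true_and, mem_Icc] at hc ⊢
        omega
    -- The first 3 is (1 + δ)/δ from the geometric sum, the second a/(a - 1) from the rescaling.
    _ ≤ 3 * endpoint u ℓ + 3 * endpoint u ℓ := by
        refine add_le_add (sum_endpoint_le hu ℓ) ((sum_le_univ_sum_of_nonneg hnn).trans ?_)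
        rw [← mul_sum]
        exact mul_le_mul_of_nonneg_left (hx.load_le i ℓ hℓ) zero_le_three
    _ = 6 * endpoint u ℓ := by ring

variable [Nonempty P]

theorem Stage.LPOptimal.exists_isRounded [Fintype J] {w : J → ℝ} (hw : ∀ j, 0 < w j)
    (hu : 0 < u) (hx : S.LPOptimal w u x) : ∃ σ, S.IsRounded u x σ := by
  obtain ⟨cls, hcls⟩ := hx.exists_classification hw hu
  obtain ⟨rank, hrank⟩ := S.exists_isSorting
  obtain ⟨proc, hproc⟩ := exists_slotRounding (cls := cls) (hx.1.truncated_nonneg hcls)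
    (hx.1.one_le_sum_truncated hu hcls) fun i => (hrank i).1
  obtain ⟨σ, rfl, hσ⟩ := S.exists_dispatched (fun k => (cls k : ℝ)) (fun _ => 0) proc
  exact ⟨σ, cls, rank, hcls, hrank, hproc, hσ⟩

theorem Stage.IsRounded.feasible (h : S.IsRounded u x σ) : S.Feasible σ := by
  obtain ⟨_, _, -, -, -, h⟩ := h
  exact h.feasible

/-- Rounding delays every task by a factor of at most `27 / 2`. -/
theorem Stage.IsRounded.completion_le (hu : 0 < u) (hx : S.LPFeasible u (S.numIntervals u) x)
    (h : S.IsRounded u x σ) (k : T) : S.completion σ k ≤ 27 / 2 * x.C k := by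
  obtain ⟨cls, rank, hcls, hrank, hr, hσ⟩ := h
  obtain ⟨hk, hlo, -⟩ := hcls k
  have h1 := hσ.completion_le (fun _ _ _ => le_rfl) k
  simp only [max_self, zero_add, Nat.cast_le] at h1
  have h2 := sum_classes_le hu hx hcls hrank hr (σ.proc k) hk
  have h3 := endpoint_succ u (cls k - 1)
  rw [Nat.sub_add_cancel (mem_Icc.1 hk).1] at h3
  rw [slack] at hlo
  linarith

variable [Fintype J] {w : J → ℝ}

theorem Stage.IsTaskScheduling.feasible (h : S.IsTaskScheduling w u σ) : S.Feasible σ := by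
  obtain ⟨_, -, h⟩ := h
  exact h.feasible

/-- Since `D` dominates `C`, the bound for tasks passes to jobs and is compared with the optimal
value of the relaxation. -/
theorem Stage.IsTaskScheduling.cost_le [DecidableEq J] (hw : ∀ j, 0 < w j) (hu : 0 < u)
    (huS : ∀ i k, u ≤ S.time i k) (h : S.IsTaskScheduling w u σ) {τ : Schedule T P}
    (hτ : S.Feasible τ) : S.cost w σ ≤ 27 / 2 * S.cost w τ := by
  obtain ⟨x, hx, h⟩ := h
  refine le_trans ?_ (mul_le_mul_of_nonneg_left (hx.sum_le_cost hu huS hτ) (by norm_num))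
  rw [Stage.cost, mul_sum]
  refine sum_le_sum fun j _ => ?_
  rw [mul_left_comm]
  refine mul_le_mul_of_nonneg_left (Stage.jobCompletion_le fun k hk => ?_) (hw j).le
  refine (h.completion_le hu hx.1 k).trans (mul_le_mul_of_nonneg_left ?_ (by norm_num))
  exact hk ▸ hx.1.dummy_last k

end TaskScheduling

end MapReduce

theorem theorem2 {J TM PM TR PR : Type*}
    [Fintype J] [Fintype TM] [Fintype PM] [Fintype TR] [Fintype PR]
    [DecidableEq J] [DecidableEq TM] [DecidableEq PM] [DecidableEq TR] [DecidableEq PR]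
    [Nonempty PM] [Nonempty PR]
    (I : MapReduce.Instance J TM PM TR PR)
    (u : ℝ) (hu : 0 < u)
    (huM : ∀ i k, u ≤ I.mapStage.time i k) (huR : ∀ i k, u ≤ I.reduceStage.time i k) :
    -- the algorithm can always be carried out
    ((∃ x, I.mapStage.LPOptimal I.weight u x) ∧
      (∀ x, I.mapStage.LPOptimal I.weight u x → ∃ σM, I.mapStage.IsRounded u x σM) ∧
      (∃ x, I.reduceStage.LPOptimal I.weight u x) ∧
      (∀ x, I.reduceStage.LPOptimal I.weight u x → ∃ σR, I.reduceStage.IsRounded u x σR) ∧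
      (∀ σM σR, I.mapStage.IsTaskScheduling I.weight u σM →
        I.reduceStage.IsTaskScheduling I.weight u σR → ∃ σ, I.IsMerged σM σR σ)) ∧
    -- each of the two separate schedules is feasible and a 27/2-approximation
    (∀ σM, I.mapStage.IsTaskScheduling I.weight u σM →
      I.mapStage.Feasible σM ∧
      ∀ τ, I.mapStage.Feasible τ →
        I.mapStage.cost I.weight σM ≤ 27 / 2 * I.mapStage.cost I.weight τ) ∧
    (∀ σR, I.reduceStage.IsTaskScheduling I.weight u σR →
      I.reduceStage.Feasible σR ∧
      ∀ τ, I.reduceStage.Feasible τ →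
        I.reduceStage.cost I.weight σR ≤ 27 / 2 * I.reduceStage.cost I.weight τ) ∧
    -- the merged schedule is feasible and a 54-approximation
    (∀ σM σR σ, I.mapStage.IsTaskScheduling I.weight u σM →
      I.reduceStage.IsTaskScheduling I.weight u σR → I.IsMerged σM σR σ →
      I.Feasible σ ∧
      ∀ τ, I.Feasible τ → I.cost σ ≤ 54 * I.cost τ) := by
  refine ⟨⟨I.mapStage.exists_lpOptimal I.weight_pos hu,
    fun x hx => hx.exists_isRounded I.weight_pos hu,
    I.reduceStage.exists_lpOptimal I.weight_pos hu,
    fun x hx => hx.exists_isRounded I.weight_pos hu,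
    fun σM σR _ _ => I.exists_isMerged σM σR⟩,
    fun σM hM => ⟨hM.feasible, fun τ hτ => hM.cost_le I.weight_pos hu huM hτ⟩,
    fun σR hR => ⟨hR.feasible, fun τ hτ => hR.cost_le I.weight_pos hu huR hτ⟩,
    fun σM σR σ hM hR h => ⟨h.feasible hM.feasible, fun τ hτ => ?_⟩⟩
  have h1 := h.cost_le hM.feasible hR.feasible
  have h2 := hM.cost_le I.weight_pos hu huM hτ.1
  have h3 := hR.cost_le I.weight_pos hu huR hτ.2.1
  have h4 := hτ.map_cost_le
  have h5 : I.reduceStage.cost I.weight τ.reduceSched = I.cost τ := rfl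
  -- The Map and the Reduce cost of `τ` are each at most its total cost, so 2(27/2 + 27/2) = 54.
  linarith
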